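/- Let $P, Q$ be complex polynomials in one variable of degrees $\ge 2$ with $P(0)=Q(0)=0$, $0<|P'(0)|<1$ and $0<|Q'(0)|<1$, and let $F:\mathbb{C}^2\to\mathbb{C}^2$, $F(z,w)=(P(z),Q(w))$. Let $\Omega$ be the immediate basin of attraction of $(0,0)$, that is, the connected component containing $(0,0)$ of the basin $\{x\in\mathbb{C}^2 : F^n(x)\to(0,0) \text{ as } n\to\infty\}$. Let $d_\Omega$ be the Kobayashi distance on $\Omega$: with $\triangle$ the open unit disk and, for $x\in\Omega$, $\xi\in\mathbb{C}^2$, $$K_\Omega(x,\xi)=\inf\{\lambda>0 : \exists f:\triangle\to\Omega \text{ holomorphic},\ f(0)=x,\ \lambda f'(0)=\xi\},$$ $d_\Omega(x,y)$ is the infimum of $\int_0^1 K_\Omega(\gamma(t),\gamma'(t))\,dt$ over all piecewise smooth curves $\gamma:[0,1]\to\Omega$ from $x$ to $y$. Then there is a constant $C<\infty$ (depending only on $P$ and $Q$) such that for every $(z_0,w_0)\in\Omega$ there is a point $(\tilde z,\tilde w)\in\Omega\cap\bigcup_{k\ge 0}F^{-k}(0,0)$ with $$d_\Omega\big((z_0,w_0),(\tilde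 z,\tilde w)\big)\le C.$$ -/

import Mathlib

open Set Filter Topology
open scoped NNReal ENNReal ContDiff

noncomputable section

/-- The Kobayashi (Royden) infinitesimal metric of `Ω` at the point `z` in the direction `ξ`: the
infimum of the `r > 0` for which there is a holomorphic map `f` from the open unit disk into `Ω`
with `f 0 = z` and `r f'(0) = ξ` (it is `∞` if there is no such `r`, e.g. if `z ∉ Ω`). -/
def kobayashiMetric {E : Type*} [NormedAddCommGroup E] [NormedSpace ℂ E]
    (Ω : Set E) (z ξ : E) : ℝ≥0∞ :=
  sInf {a : ℝ≥0∞ | ∃ r : ℝ, 0 < r ∧ a = ENNReal.ofReal r ∧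
    ∃ f : ℂ → E, DifferentiableOn ℂ f (Metric.ball 0 1) ∧ MapsTo f (Metric.ball 0 1) Ω ∧
      f 0 = z ∧ (r : ℂ) • deriv f 0 = ξ}

/-- `γ` restricted to `[0, 1]` is continuous, and there is a partition
`0 = t₀ < t₁ < ⋯ < tₙ = 1` such that `γ` is smooth on each closed interval `[tᵢ, tᵢ₊₁]`. -/
def IsPiecewiseSmooth {E : Type*} [NormedAddCommGroup E] [NormedSpace ℂ E]
    (γ : ℝ → E) : Prop :=
  ContinuousOn γ (Icc 0 1) ∧
    ∃ (n : ℕ) (t : Fin (n + 1) → ℝ), StrictMono t ∧ t 0 = 0 ∧ t (Fin.last n) = 1 ∧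
      ∀ i : Fin n, ContDiffOn ℝ ∞ γ (Icc (t i.castSucc) (t i.succ))

/-- The Kobayashi length of the curve `γ : [0, 1] → Ω`. -/
def kobayashiLength {E : Type*} [NormedAddCommGroup E] [NormedSpace ℂ E]
    (Ω : Set E) (γ : ℝ → E) : ℝ≥0∞ :=
  ∫⁻ t in Icc (0 : ℝ) 1, kobayashiMetric Ω (γ t) (deriv γ t)

/-- The Kobayashi distance on `Ω`: the infimum of the Kobayashi lengths of the piecewise smooth
curves in `Ω` from `p` to `q` (it is `∞` if there is no such curve). -/
def kobayashiDist {E : Type*} [NormedAddCommGroup E] [NormedSpace ℂ E]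
    (Ω : Set E) (p q : E) : ℝ≥0∞ :=
  sInf {a : ℝ≥0∞ | ∃ γ : ℝ → E, IsPiecewiseSmooth γ ∧ MapsTo γ (Icc 0 1) Ω ∧
    γ 0 = p ∧ γ 1 = q ∧ a = kobayashiLength Ω γ}

/-- The basin of attraction of `p`: the points whose orbit under `F` converges to `p`. -/
def attractingBasin {X : Type*} [TopologicalSpace X] (F : X → X) (p : X) : Set X :=
  {x | Tendsto (fun n : ℕ => F^[n] x) atTop (𝓝 p)}

/-- The immediate basin of `p`: the connected component of the basin of attraction containing
`p`. -/
def immediateBasin {X : Type*} [TopologicalSpace X] (F : X → X) (p : X) : Set X :=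
  connectedComponentIn (attractingBasin F p) p

/-- The backward orbit `⋃_{k ≥ 0} F^{-k}(p)`. -/
def backwardOrbit {X : Type*} (F : X → X) (p : X) : Set X :=
  ⋃ k : ℕ, F^[k] ⁻¹' {p}

/-- The product map `(z, w) ↦ (P(z), Q(w))` of `ℂ²`. -/
def productMap (P Q : Polynomial ℂ) (x : ℂ × ℂ) : ℂ × ℂ :=
  (P.eval x.1, Q.eval x.2)

end

/-!
For one polynomial `P`, join every point `z` of the immediate basin `Ω` of the fixed point `p` to
the backward orbit of `p` by a chain of holomorphic discs in `Ω` whose length is bounded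
independently of `z`; each disc contributes at most `1` to the Kobayashi distance. Let `S` be the
closure of the orbits of the critical values attracted to `p`, a countable compact set, and let `U`
be a small disc about `p`. For large `m` the set `S` lies in `P⁻ᵐ(U)`. Every orbit in `Ω` starting
outside `P⁻ᵐ(U)` meets the compact fundamental annulus `P⁻ᵐ⁻¹(closure U) \ P⁻ᵐ(U)`, and compactness
gives a uniform bound on the length of chains in the connected open set `Ω \ S` from points of this
annulus to a point `a ∉ P⁻ᵐ(U)` of the backward orbit of `p`. Off `S` the iterates of `P` are
coverings, so discs lift, and a chain from `Pᵏ(z)` to `a` lifts to a chain of the same length from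
`z` to a point of `P⁻ᵏ(a)`. Chains in the two factors combine to chains in the product.

A preimage `b ≠ p` of `p` in `Ω` exists because otherwise the slopes `(Pⁿ(z) - p) / (z - p)` would
have no zeros in `Ω` and be bounded below on its boundary uniformly in `n`, whereas their value at
`p`, namely `P'(p)ⁿ`, tends to `0`.
-/

section PiecewiseSmooth

open Relation (ReflTransGen)

variable {E : Type*} [NormedAddCommGroup E] [NormedSpace ℂ E] {γ σ γ₁ γ₂ : ℝ → E} {a b : ℝ}

/-- `γ` is smooth on the nondegenerate interval `[a, b]`. The reflexive transitive closure of this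
relation between `a` and `b` says that `γ` is smooth on each interval of a partition of `[a, b]`. -/
def SmoothPiece (γ : ℝ → E) (a b : ℝ) : Prop :=
  a < b ∧ ContDiffOn ℝ ∞ γ (Icc a b)

theorem reflTransGen_smoothPiece_iff_exists_partition :
    ReflTransGen (SmoothPiece γ) a b ↔
      ∃ (n : ℕ) (t : Fin (n + 1) → ℝ), StrictMono t ∧ t 0 = a ∧ t (Fin.last n) = b ∧
        ∀ i : Fin n, ContDiffOn ℝ ∞ γ (Icc (t i.castSucc) (t i.succ)) := by
  refine ⟨fun h => ?_, ?_⟩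
  · induction h using ReflTransGen.head_induction_on with
    | refl => exact ⟨0, fun _ => b, Fin.strictMono_iff_lt_succ.2 nofun, rfl, rfl, nofun⟩
    | @head a c hac _ ih =>
      obtain ⟨n, t, ht, rfl, htb, hsmooth⟩ := ih
      exact ⟨n + 1, Matrix.vecCons a t, ht.vecCons hac.1, rfl, htb, Fin.cases hac.2 hsmooth⟩
  · rintro ⟨n, t, ht, rfl, rfl, hsmooth⟩
    induction n with
    | zero => exact .refl
    | succ n ih =>
      exact .head ⟨ht (Fin.succ_pos 0), hsmooth 0⟩
        (ih (fun i => t i.succ) (ht.comp Fin.strictMono_succ) fun i => hsmooth i.succ)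

theorem isPiecewiseSmooth_iff_reflTransGen :
    IsPiecewiseSmooth γ ↔ ContinuousOn γ (Icc 0 1) ∧ ReflTransGen (SmoothPiece γ) 0 1 := by
  rw [IsPiecewiseSmooth, reflTransGen_smoothPiece_iff_exists_partition]

theorem isPiecewiseSmooth_of_contDiffOn (h : ContDiffOn ℝ ∞ γ (Icc 0 1)) : IsPiecewiseSmooth γ :=
  isPiecewiseSmooth_iff_reflTransGen.2 ⟨h.continuousOn, .single ⟨one_pos, h⟩⟩

theorem le_of_reflTransGen_smoothPiece (h : ReflTransGen (SmoothPiece γ) a b) : a ≤ b := by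
  induction h with
  | refl => rfl
  | tail _ hbc ih => exact ih.trans hbc.1.le

theorem reflTransGen_smoothPiece_congr (h : ReflTransGen (SmoothPiece γ) a b)
    (hσ : EqOn σ γ (Icc a b)) : ReflTransGen (SmoothPiece σ) a b := by
  induction h with
  | refl => exact .refl
  | @tail b c hab hbc ih =>
    exact .tail (ih (hσ.mono (Icc_subset_Icc_right hbc.1.le)))
      ⟨hbc.1, hbc.2.congr (hσ.mono (Icc_subset_Icc_left (le_of_reflTransGen_smoothPiece hab)))⟩

theorem reflTransGen_smoothPiece_comp_mul_sub (h : ReflTransGen (SmoothPiece γ) a b) {k : ℝ}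
    (hk : 0 < k) (c : ℝ) :
    ReflTransGen (SmoothPiece fun x => γ (k * x - c)) ((a + c) / k) ((b + c) / k) := by
  refine h.lift (fun x => (x + c) / k) fun x y hxy => ⟨?_, ?_⟩
  · exact div_lt_div_of_pos_right (add_lt_add_left hxy.1 c) hk
  · refine hxy.2.comp (by fun_prop) fun z hz => ?_
    rw [mem_Icc, div_le_iff₀' hk, le_div_iff₀' hk] at hz
    exact ⟨by linarith, by linarith⟩

/-- The concatenation of curves on `[0, 1]`: first `γ₁`, then `γ₂`, both at double speed. -/
noncomputable def concatCurve {X : Type*} (γ₁ γ₂ : ℝ → X) (x : ℝ) : X :=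
  if x ≤ 1 / 2 then γ₁ (2 * x) else γ₂ (2 * x - 1)

theorem concatCurve_eqOn_left {X : Type*} (γ₁ γ₂ : ℝ → X) :
    EqOn (concatCurve γ₁ γ₂) (fun x => γ₁ (2 * x)) (Iic (1 / 2)) := fun _ hx => if_pos hx

theorem concatCurve_eqOn_right {X : Type*} {γ₁ γ₂ : ℝ → X} (h : γ₁ 1 = γ₂ 0) :
    EqOn (concatCurve γ₁ γ₂) (fun x => γ₂ (2 * x - 1)) (Ici (1 / 2)) := by
  intro x hx
  rcases (mem_Ici.1 hx).eq_or_lt with rfl | hlt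
  · simp [concatCurve, h]
  · exact if_neg hlt.not_ge

theorem mapsTo_concatCurve {X : Type*} {γ₁ γ₂ : ℝ → X} {Ω : Set X} (h₁ : MapsTo γ₁ (Icc 0 1) Ω)
    (h₂ : MapsTo γ₂ (Icc 0 1) Ω) : MapsTo (concatCurve γ₁ γ₂) (Icc 0 1) Ω := by
  rintro x ⟨hx0, hx1⟩
  unfold concatCurve
  split_ifs with hx
  · exact h₁ ⟨by linarith, by linarith⟩
  · exact h₂ ⟨by linarith, by linarith⟩

theorem IsPiecewiseSmooth.concatCurve (h₁ : IsPiecewiseSmooth γ₁) (h₂ : IsPiecewiseSmooth γ₂)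
    (h : γ₁ 1 = γ₂ 0) : IsPiecewiseSmooth (concatCurve γ₁ γ₂) := by
  rw [isPiecewiseSmooth_iff_reflTransGen] at h₁ h₂ ⊢
  have hleft := (concatCurve_eqOn_left γ₁ γ₂).mono (Icc_subset_Iic_self : Icc (0 : ℝ) (1 / 2) ⊆ _)
  have hright := (concatCurve_eqOn_right h).mono (Icc_subset_Ici_self : Icc (1 / 2 : ℝ) 1 ⊆ _)
  refine ⟨?_, .trans (b := 1 / 2) ?_ ?_⟩
  · rw [← Icc_union_Icc_eq_Icc (b := (1 / 2 : ℝ)) (by norm_num) (by norm_num)]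
    refine .union_of_isClosed ?_ ?_ isClosed_Icc isClosed_Icc
    · refine .congr (h₁.1.comp (by fun_prop) fun x hx => ?_) hleft
      exact ⟨by linarith [hx.1], by linarith [hx.2]⟩
    · refine .congr (h₂.1.comp (by fun_prop) fun x hx => ?_) hright
      exact ⟨by linarith [hx.1], by linarith [hx.2]⟩
  · refine reflTransGen_smoothPiece_congr ?_ hleft
    simpa using reflTransGen_smoothPiece_comp_mul_sub h₁.2 two_pos 0
  · refine reflTransGen_smoothPiece_congr ?_ hright
    convert reflTransGen_smoothPiece_comp_mul_sub h₂.2 two_pos 1 using 1 <;> norm_num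

end PiecewiseSmooth

section Kobayashi

open MeasureTheory

variable {E : Type*} [NormedAddCommGroup E] [NormedSpace ℂ E] {Ω : Set E}

theorem kobayashiMetric_deriv_le_one {f : ℂ → E} (hf : DifferentiableOn ℂ f (Metric.ball 0 1))
    (hfΩ : MapsTo f (Metric.ball 0 1) Ω) : kobayashiMetric Ω (f 0) (deriv f 0) ≤ 1 :=
  sInf_le ⟨1, one_pos, ENNReal.ofReal_one.symm, f, hf, hfΩ, rfl, by simp⟩

theorem kobayashiMetric_smul_le (Ω : Set E) (z ξ : E) {c : ℝ} (hc : 0 < c) :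
    kobayashiMetric Ω z (c • ξ) ≤ ENNReal.ofReal c * kobayashiMetric Ω z ξ := by
  have hc0 : ENNReal.ofReal c ≠ 0 := by simpa using hc
  rw [mul_comm, ← ENNReal.div_le_iff hc0 ENNReal.ofReal_ne_top]
  refine le_sInf ?_
  rintro _ ⟨r, hr, rfl, f, hf, hfΩ, hf0, rfl⟩
  rw [ENNReal.div_le_iff hc0 ENNReal.ofReal_ne_top, ← ENNReal.ofReal_mul hr.le]
  refine sInf_le ⟨r * c, mul_pos hr hc, rfl, f, hf, hfΩ, hf0, ?_⟩
  rw [← Complex.coe_smul, smul_smul, mul_comm r c, Complex.ofReal_mul]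

theorem lintegral_kobayashiMetric_le_of_eqOn_comp_mul_sub (Ω : Set E) {γ σ : ℝ → E}
    {a b c k : ℝ} (hk : 0 < k) (hσ : EqOn σ (fun x => γ (k * x - c)) (Ioo a b))
    (hmaps : MapsTo (fun x => k * x - c) (Ioo a b) (Icc 0 1)) :
    ∫⁻ x in Icc a b, kobayashiMetric Ω (σ x) (deriv σ x) ≤ kobayashiLength Ω γ := by
  have hderiv : ∀ x ∈ Ioo a b, deriv σ x = k • deriv γ (k * x - c) := fun x hx => by
    rw [(hσ.eventuallyEq_of_mem (Ioo_mem_nhds hx.1 hx.2)).deriv_eq,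
      deriv_comp_mul_left k (fun y => γ (y - c)), deriv_comp_sub_const]
  calc ∫⁻ x in Icc a b, kobayashiMetric Ω (σ x) (deriv σ x)
      = ∫⁻ x in Ioo a b, kobayashiMetric Ω (σ x) (deriv σ x) :=
        (setLIntegral_congr Ioo_ae_eq_Icc).symm
    _ ≤ ∫⁻ x in Ioo a b, ENNReal.ofReal |k| *
          kobayashiMetric Ω (γ (k * x - c)) (deriv γ (k * x - c)) := by
        refine setLIntegral_mono' measurableSet_Ioo fun x hx => ?_
        rw [hσ hx, hderiv x hx, abs_of_pos hk]
        exact kobayashiMetric_smul_le Ω _ _ hk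
    _ = ∫⁻ y in (fun x => k * x - c) '' Ioo a b, kobayashiMetric Ω (γ y) (deriv γ y) := by
        refine (lintegral_image_eq_lintegral_abs_deriv_mul (f' := fun _ => k) measurableSet_Ioo
          (fun x _ => ?_) (fun x _ y _ hxy => ?_)
          fun y => kobayashiMetric Ω (γ y) (deriv γ y)).symm
        · simpa using (((hasDerivAt_id x).const_mul k).sub_const c).hasDerivWithinAt
        · simpa [hk.ne'] using hxy
    _ ≤ kobayashiLength Ω γ := lintegral_mono_set hmaps.image_subset

theorem kobayashiLength_concatCurve_le (Ω : Set E) {γ₁ γ₂ : ℝ → E} (h : γ₁ 1 = γ₂ 0) :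
    kobayashiLength Ω (concatCurve γ₁ γ₂) ≤ kobayashiLength Ω γ₁ + kobayashiLength Ω γ₂ := by
  rw [kobayashiLength, ← Icc_union_Icc_eq_Icc (b := (1 / 2 : ℝ)) (by norm_num) (by norm_num)]
  refine (lintegral_union_le _ _ _).trans (add_le_add ?_ ?_)
  · refine lintegral_kobayashiMetric_le_of_eqOn_comp_mul_sub Ω (c := 0) two_pos ?_ fun x hx => ?_
    · simpa only [sub_zero] using (concatCurve_eqOn_left γ₁ γ₂).mono fun x hx => hx.2.le
    · exact ⟨by linarith [hx.1], by linarith [hx.2]⟩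
  · refine lintegral_kobayashiMetric_le_of_eqOn_comp_mul_sub Ω (c := 1) two_pos ?_ fun x hx => ?_
    · exact (concatCurve_eqOn_right h).mono fun x hx => hx.1.le
    · exact ⟨by linarith [hx.1], by linarith [hx.2]⟩

theorem kobayashiDist_triangle (Ω : Set E) (x y z : E) :
    kobayashiDist Ω x z ≤ kobayashiDist Ω x y + kobayashiDist Ω y z := by
  rw [kobayashiDist, kobayashiDist, kobayashiDist, sInf_eq_iInf', sInf_eq_iInf', sInf_eq_iInf']
  refine ENNReal.le_iInf_add_iInf ?_
  rintro ⟨_, γ₁, hγ₁, hΩ₁, rfl, h, rfl⟩ ⟨_, γ₂, hγ₂, hΩ₂, rfl, rfl, rfl⟩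
  refine (iInf_le _ ⟨_, concatCurve γ₁ γ₂, hγ₁.concatCurve hγ₂ h, mapsTo_concatCurve hΩ₁ hΩ₂,
    ?_, ?_, rfl⟩).trans (kobayashiLength_concatCurve_le Ω h)
  · simp [concatCurve]
  · norm_num [concatCurve]

/-- `y` lies on a holomorphic disc in `Ω` centred at `x`, at a parameter of modulus at most `1/2`;
the bound `1/2` gives `kobayashiDist Ω x y ≤ 1`. -/
def DiscLinked (Ω : Set E) (x y : E) : Prop :=
  ∃ f : ℂ → E, DifferentiableOn ℂ f (Metric.ball 0 1) ∧ MapsTo f (Metric.ball 0 1) Ω ∧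
    f 0 = x ∧ ∃ s : ℂ, ‖s‖ ≤ 1 / 2 ∧ f s = y

theorem DiscLinked.refl {x : E} (hx : x ∈ Ω) : DiscLinked Ω x x :=
  ⟨fun _ => x, differentiableOn_const x, fun _ _ => hx, rfl, 0, by simp, rfl⟩

theorem mem_unitBall_of_norm_le_half {s : ℂ} (hs : ‖s‖ ≤ 1 / 2) : s ∈ Metric.ball (0 : ℂ) 1 :=
  mem_ball_zero_iff.2 (hs.trans_lt (by norm_num))

theorem DiscLinked.mem_right {x y : E} (h : DiscLinked Ω x y) : y ∈ Ω := by
  obtain ⟨f, _, hfΩ, _, s, hs, rfl⟩ := h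
  exact hfΩ (mem_unitBall_of_norm_le_half hs)

theorem kobayashiMetric_smul_deriv_le_one {f : ℂ → E}
    (hf : DifferentiableOn ℂ f (Metric.ball 0 1)) (hfΩ : MapsTo f (Metric.ball 0 1) Ω) {w s : ℂ}
    (hw : w ∈ Metric.ball (0 : ℂ) 1) (hs : ‖w‖ + ‖s‖ ≤ 1) :
    kobayashiMetric Ω (f w) (s • deriv f w) ≤ 1 := by
  have hmaps : MapsTo (fun ζ : ℂ => s * ζ + w) (Metric.ball 0 1) (Metric.ball 0 1) := by
    intro ζ hζ
    rw [mem_ball_zero_iff] at hw hζ ⊢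
    have hle : ‖s * ζ + w‖ ≤ ‖s‖ * ‖ζ‖ + ‖w‖ := (norm_add_le _ _).trans_eq (by rw [norm_mul])
    nlinarith [norm_nonneg s, norm_nonneg ζ]
  have hderiv : deriv (fun ζ => f (s * ζ + w)) 0 = s • deriv f w := by
    rw [deriv_comp_mul_left s (fun ζ => f (ζ + w)), deriv_comp_add_const]
    simp
  simpa [Function.comp_def, hderiv] using
    kobayashiMetric_deriv_le_one (hf.comp (by fun_prop) hmaps) (hfΩ.comp hmaps)

theorem DiscLinked.kobayashiDist_le_one [CompleteSpace E] {x y : E} (h : DiscLinked Ω x y) :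
    kobayashiDist Ω x y ≤ 1 := by
  obtain ⟨f, hf, hfΩ, rfl, s, hs, rfl⟩ := h
  have hnorm : ∀ t ∈ Icc (0 : ℝ) 1, ‖t * s‖ ≤ 1 / 2 := fun t ht => by
    rw [norm_mul, Complex.norm_real, Real.norm_of_nonneg ht.1]
    exact (mul_le_of_le_one_left (norm_nonneg s) ht.2).trans hs
  have hball : MapsTo (fun t : ℝ => t * s) (Icc 0 1) (Metric.ball 0 1) := fun t ht =>
    mem_unitBall_of_norm_le_half (hnorm t ht)
  have hsmooth : ContDiffOn ℝ ∞ (fun t : ℝ => f (t * s)) (Icc 0 1) :=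
    ((hf.contDiffOn Metric.isOpen_ball).restrict_scalars ℝ).comp
      (Complex.ofRealCLM.contDiff.mul contDiff_const).contDiffOn hball
  have hderiv : ∀ t ∈ Icc (0 : ℝ) 1, deriv (fun t : ℝ => f (t * s)) t = s • deriv f (t * s) := by
    intro t ht
    have hft := hf.differentiableAt (Metric.isOpen_ball.mem_nhds (hball ht))
    simpa [Function.comp_def] using
      (hft.hasDerivAt.scomp t (Complex.ofRealCLM.hasDerivAt.mul_const s)).deriv
  calc kobayashiDist Ω (f 0) (f s) ≤ kobayashiLength Ω (fun t : ℝ => f (t * s)) :=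
        sInf_le ⟨_, isPiecewiseSmooth_of_contDiffOn hsmooth, hfΩ.comp hball, by simp, by simp, rfl⟩
    _ ≤ ∫⁻ _ in Icc (0 : ℝ) 1, 1 := setLIntegral_mono' measurableSet_Icc fun t ht => by
        rw [hderiv t ht]
        exact kobayashiMetric_smul_deriv_le_one hf hfΩ (hball ht) (by linarith [hnorm t ht])
    _ = 1 := by simp

theorem DiscLinked.map {E' : Type*} [NormedAddCommGroup E'] [NormedSpace ℂ E'] {g : E → E'}
    (hg : Differentiable ℂ g) {Ω' : Set E'} (hΩ : MapsTo g Ω Ω') {x y : E}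
    (h : DiscLinked Ω x y) : DiscLinked Ω' (g x) (g y) := by
  obtain ⟨f, hf, hfΩ, rfl, s, hs, rfl⟩ := h
  exact ⟨g ∘ f, hg.comp_differentiableOn hf, hΩ.comp hfΩ, rfl, s, hs, rfl⟩

/-- `x` and `y` are joined in `Ω` by a chain of `n` holomorphic discs, consecutive points of the
chain being linked by `DiscLinked`. -/
inductive DiscChain (Ω : Set E) : ℕ → E → E → Prop
  | nil (x : E) : DiscChain Ω 0 x x
  | cons {n : ℕ} {x y z : E} : DiscLinked Ω x y → DiscChain Ω n y z → DiscChain Ω (n + 1) x z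

namespace DiscChain

variable {m n : ℕ} {x y z : E}

theorem trans (h₁ : DiscChain Ω n x y) (h₂ : DiscChain Ω m y z) : DiscChain Ω (m + n) x z := by
  induction h₁ with
  | nil => exact h₂
  | cons hlink _ ih => exact .cons hlink (ih h₂)

theorem mono (h : DiscChain Ω n x y) (hx : x ∈ Ω) (hnm : n ≤ m) : DiscChain Ω m x y := by
  induction hnm with
  | refl => exact h
  | step _ ih => exact .cons (.refl hx) ih

variable {E' : Type*} [NormedAddCommGroup E'] [NormedSpace ℂ E'] {Ω' : Set E'}

theorem map {g : E → E'} (hg : Differentiable ℂ g) (hΩ : MapsTo g Ω Ω')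
    (h : DiscChain Ω n x y) : DiscChain Ω' n (g x) (g y) := by
  induction h with
  | nil => exact .nil _
  | cons hlink _ ih => exact .cons (hlink.map hg hΩ) ih

theorem prod {x' y' : E'} (h : DiscChain Ω n x y) (h' : DiscChain Ω' m x' y') (hx' : x' ∈ Ω')
    (hy : y ∈ Ω) : DiscChain (Ω ×ˢ Ω') (m + n) (x, x') (y, y') :=
  (h.map (Ω' := Ω ×ˢ Ω') (g := fun u => (u, x')) (by fun_prop) fun _ hu => ⟨hu, hx'⟩).trans
    (h'.map (g := fun v => (y, v)) (by fun_prop) fun _ hv => ⟨hy, hv⟩)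

theorem kobayashiDist_le [CompleteSpace E] (h : DiscChain Ω n x y) (hx : x ∈ Ω) :
    kobayashiDist Ω x y ≤ (n + 1 : ℕ) := by
  induction h with
  | nil => simpa using (DiscLinked.refl hx).kobayashiDist_le_one
  | @cons n x y z hlink _ ih =>
    calc kobayashiDist Ω x z ≤ kobayashiDist Ω x y + kobayashiDist Ω y z :=
          kobayashiDist_triangle Ω x y z
      _ ≤ 1 + (n + 1 : ℕ) := add_le_add hlink.kobayashiDist_le_one (ih hlink.mem_right)
      _ = (n + 1 + 1 : ℕ) := by
          push_cast
          ring

end DiscChain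

end Kobayashi

section DiscChainsInDomains

variable {E : Type*} [NormedAddCommGroup E] [NormedSpace ℂ E] {W : Set E}

theorem discLinked_of_ball_subset {x y : E} {ε : ℝ} (hε : 0 < ε) (hW : Metric.ball x ε ⊆ W)
    (hxy : 2 * dist y x ≤ ε) : DiscLinked W x y := by
  refine ⟨fun ζ => x + ζ • (2 : ℝ) • (y - x), by fun_prop, fun ζ hζ => hW ?_, by simp, 1 / 2,
    by simp, ?_⟩
  · rw [mem_ball_zero_iff] at hζ
    rw [mem_ball_iff_norm, add_sub_cancel_left, norm_smul, norm_smul, Real.norm_two,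
      ← dist_eq_norm]
    nlinarith [norm_nonneg ζ]
  · simp [← Complex.coe_smul, smul_smul]

theorem eventually_discLinked {x : E} (hW : W ∈ 𝓝 x) :
    ∀ᶠ y in 𝓝 x, DiscLinked W x y ∧ DiscLinked W y x := by
  obtain ⟨ε, hε, hball⟩ := Metric.mem_nhds_iff.1 hW
  filter_upwards [Metric.ball_mem_nhds x (show 0 < ε / 4 by positivity)] with y hy
  rw [Metric.mem_ball] at hy
  refine ⟨discLinked_of_ball_subset hε hball (by linarith),
    discLinked_of_ball_subset (half_pos hε)
      ((Metric.ball_subset_ball' (by linarith)).trans hball) ?_⟩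
  rw [dist_comm]
  linarith

theorem exists_discChain (hW : IsOpen W) (hWc : IsPreconnected W) {x y : E} (hx : x ∈ W)
    (hy : y ∈ W) : ∃ n, DiscChain W n x y := by
  refine hWc.induction₂' (fun x y => ∃ n, DiscChain W n x y) (fun x hx => ?_) ?_ hx hy
  · filter_upwards [mem_nhdsWithin_of_mem_nhds (eventually_discLinked (hW.mem_nhds hx))] with y hy
    exact ⟨⟨1, .cons hy.1 (.nil y)⟩, 1, .cons hy.2 (.nil x)⟩
  · rintro x y z - - - ⟨n, hxy⟩ ⟨m, hyz⟩
    exact ⟨m + n, hxy.trans hyz⟩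

theorem exists_forall_discChain_of_isCompact {K : Set E} (hK : IsCompact K) (hKW : K ⊆ W)
    (hW : IsOpen W) (hWc : IsPreconnected W) {a : E} (ha : a ∈ W) :
    ∃ N, ∀ x ∈ K, DiscChain W N x a := by
  suffices h : ∃ N, ∀ x ∈ K, x ∈ W → DiscChain W N x a from
    h.imp fun N hN x hx => hN x hx (hKW hx)
  refine hK.induction_on (p := fun s => ∃ N, ∀ x ∈ s, x ∈ W → DiscChain W N x a) ⟨0, by simp⟩
    (fun s t hst h => h.imp fun N hN x hx => hN x (hst hx)) ?_ fun x hx => ?_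
  · rintro s t ⟨N, hN⟩ ⟨M, hM⟩
    refine ⟨max N M, fun x hx hxW => hx.elim (fun hx => ?_) fun hx => ?_⟩
    · exact (hN x hx hxW).mono hxW (le_max_left N M)
    · exact (hM x hx hxW).mono hxW (le_max_right N M)
  · obtain ⟨n, hn⟩ := exists_discChain hW hWc (hKW hx) ha
    exact ⟨_, mem_nhdsWithin_of_mem_nhds (eventually_discLinked (hW.mem_nhds (hKW hx))), n + 1,
      fun y hy _ => .cons hy.2 hn⟩

end DiscChainsInDomains

section DiffCountable

variable {E : Type*} [NormedAddCommGroup E] [NormedSpace ℝ E] {S : Set E}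

theorem isPreconnected_ball_diff_countable (hE : 1 < Module.rank ℝ E) (hS : S.Countable) (x : E)
    {r : ℝ} (hr : 0 < r) : IsPreconnected (Metric.ball x r \ S) := by
  have hbij : BijOn (OpenPartialHomeomorph.univBall x r) univ (Metric.ball x r) := by
    simpa [OpenPartialHomeomorph.univBall_target x hr] using
      (OpenPartialHomeomorph.univBall x r).bijOn
  have hinj := injOn_univ.1 hbij.injOn
  rw [← hbij.image_eq, ← image_sdiff_preimage, ← compl_eq_univ_sdiff]
  exact ((hS.preimage hinj).isConnected_compl_of_one_lt_rank hE).isPreconnected.image _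
    (OpenPartialHomeomorph.continuous_univBall x r).continuousOn

theorem isPreconnected_diff_countable (hE : 1 < Module.rank ℝ E) (hS : S.Countable) {Ω : Set E}
    (hΩ : IsOpen Ω) (hΩc : IsPreconnected Ω) : IsPreconnected (Ω \ S) := by
  have : Nontrivial E := (rank_pos_iff_nontrivial (R := ℝ)).1 (zero_lt_one.trans hE)
  have hball : ∀ x ∈ Ω, ∃ ε > 0, Metric.ball x ε \ S ⊆ Ω \ S := fun x hx =>
    (Metric.isOpen_iff.1 hΩ x hx).imp fun ε h => ⟨h.1, sdiff_subset_sdiff_left h.2⟩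
  let Joined (x y : E) : Prop := ∃ t ⊆ Ω \ S, IsPreconnected t ∧ x ∈ closure t ∧ y ∈ closure t
  have hjoined : ∀ x ∈ Ω, ∀ y ∈ Ω, Joined x y := by
    intro x hx y hy
    refine hΩc.induction₂ Joined (fun x hx => ?_) ?_
      (fun x y _ _ ⟨t, ht, htc, hxt, hyt⟩ => ⟨t, ht, htc, hyt, hxt⟩) hx hy
    · obtain ⟨ε, hε, hεΩ⟩ := hball x hx
      have hdense : Metric.ball x ε ⊆ closure (Metric.ball x ε \ S) :=
        (hS.dense_compl ℝ).open_subset_closure_inter Metric.isOpen_ball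
      filter_upwards [mem_nhdsWithin_of_mem_nhds (Metric.ball_mem_nhds x hε)] with y hy
      exact ⟨_, hεΩ, isPreconnected_ball_diff_countable hE hS x hε,
        hdense (Metric.mem_ball_self hε), hdense hy⟩
    · rintro x y z - hy - ⟨t, ht, htc, hxt, hyt⟩ ⟨u, hu, huc, hyu, hzu⟩
      obtain ⟨ε, hε, hεΩ⟩ := hball y hy
      have hε_nhds := Metric.ball_mem_nhds y hε
      obtain ⟨p, hpε, hpt⟩ := mem_closure_iff_nhds.1 hyt _ hε_nhds
      obtain ⟨q, hqε, hqu⟩ := mem_closure_iff_nhds.1 hyu _ hε_nhds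
      refine ⟨t ∪ Metric.ball y ε \ S ∪ u, union_subset (union_subset ht hεΩ) hu, ?_,
        closure_mono (subset_union_left.trans subset_union_left) hxt,
        closure_mono subset_union_right hzu⟩
      have hball_c := isPreconnected_ball_diff_countable hE hS y hε
      exact (htc.union p hpt (mem_sdiff_of_mem hpε (ht hpt).2) hball_c).union q
        (mem_union_right t (mem_sdiff_of_mem hqε (hu hqu).2)) hqu huc
  refine isPreconnected_of_forall_pair fun x hx y hy => ?_
  obtain ⟨t, ht, htc, hxt, hyt⟩ := hjoined x hx.1 y hy.1
  exact ⟨insert x (insert y t), insert_subset hx (insert_subset hy ht), by simp, by simp,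
    htc.subset_closure ((subset_insert _ _).trans (subset_insert _ _))
      (insert_subset hxt (insert_subset hyt subset_closure))⟩

end DiffCountable

section Lifting

theorem exists_disc_lift (P : Polynomial ℂ) {W : Set ℂ}
    (hW : ∀ z, P.eval z ∈ W → P.derivative.eval z ≠ 0) {f : ℂ → ℂ}
    (hf : DifferentiableOn ℂ f (Metric.ball 0 1)) (hfW : MapsTo f (Metric.ball 0 1) W) {z : ℂ}
    (hz : P.eval z = f 0) :
    ∃ g : ℂ → ℂ, DifferentiableOn ℂ g (Metric.ball 0 1) ∧ g 0 = z ∧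
      EqOn (P.eval ∘ g) f (Metric.ball 0 1) := by
  have : ContractibleSpace (Metric.ball (0 : ℂ) 1) := Metric.contractibleSpace_ball one_pos
  have : LocallyPathConnectedSpace (Metric.ball (0 : ℂ) 1) :=
    Metric.isOpen_ball.locallyPathConnectedSpace
  obtain ⟨G, ⟨hG0, hPG⟩, -⟩ := P.isCoveringMapOn_eval.existsUnique_continuousMap_lifts
    ⟨_, hf.continuousOn.domRestrict⟩ (a₀ := ⟨0, Metric.mem_ball_self one_pos⟩) hz <| by
      rintro ζ ⟨y, hy, hyζ : P.eval y = f ζ⟩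
      exact hW y (hyζ ▸ hfW ζ.2) hy
  let g := Function.extend Subtype.val G 0
  have hg : ∀ ζ : Metric.ball (0 : ℂ) 1, g ζ = G ζ := Subtype.val_injective.extend_apply G 0
  have hg_cont : ContinuousOn g (Metric.ball 0 1) :=
    continuousOn_iff_continuous_domRestrict.2 (G.continuous.congr fun ζ => (hg ζ).symm)
  have hPg : EqOn (P.eval ∘ g) f (Metric.ball 0 1) := fun ζ hζ => by
    simpa [hg ⟨ζ, hζ⟩] using congrFun hPG ⟨ζ, hζ⟩
  refine ⟨g, fun ζ hζ => ?_, (hg ⟨0, Metric.mem_ball_self one_pos⟩).trans hG0, hPg⟩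
  have hnhds := Metric.isOpen_ball.mem_nhds hζ
  have hder : P.derivative.eval (g ζ) ≠ 0 := hW _ (hfW.congr hPg.symm hζ)
  exact ((P.hasDerivAt (g ζ)).of_comp_left (hg_cont.continuousAt hnhds)
    (hf.differentiableAt hnhds).hasDerivAt hder
    (hPg.eventuallyEq_of_mem hnhds)).differentiableAt.differentiableWithinAt

theorem DiscLinked.exists_lift {P : Polynomial ℂ} {W : Set ℂ}
    (hW : ∀ z, P.eval z ∈ W → P.derivative.eval z ≠ 0) {z w : ℂ}
    (h : DiscLinked W (P.eval z) w) :
    ∃ z', P.eval z' = w ∧ DiscLinked (P.eval ⁻¹' W) z z' := by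
  obtain ⟨f, hf, hfW, hf0, s, hs, rfl⟩ := h
  obtain ⟨g, hg, hg0, hPg⟩ := exists_disc_lift P hW hf hfW hf0.symm
  exact ⟨g s, hPg (mem_unitBall_of_norm_le_half hs), g, hg,
    (hfW.congr hPg.symm : MapsTo (P.eval ∘ g) _ W), hg0, s, hs, rfl⟩

theorem DiscChain.exists_lift {P : Polynomial ℂ} {W : Set ℂ}
    (hW : ∀ z, P.eval z ∈ W → P.derivative.eval z ≠ 0) {n : ℕ} {x w : ℂ}
    (h : DiscChain W n x w) {z : ℂ} (hz : P.eval z = x) :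
    ∃ z', P.eval z' = w ∧ DiscChain (P.eval ⁻¹' W) n z z' := by
  induction h generalizing z with
  | nil => exact ⟨z, hz, .nil z⟩
  | cons hlink _ ih =>
    subst hz
    obtain ⟨y, hy, hzy⟩ := hlink.exists_lift hW
    obtain ⟨z', hz', hyz'⟩ := ih hy
    exact ⟨z', hz', .cons hzy hyz'⟩

theorem DiscChain.exists_lift_iterate {P : Polynomial ℂ} {W : Set ℂ}
    (hW : ∀ z, P.eval z ∈ W → P.derivative.eval z ≠ 0) (hPW : P.eval ⁻¹' W ⊆ W) {n : ℕ} {w : ℂ}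
    (k : ℕ) {z : ℂ} (h : DiscChain W n (P.eval^[k] z) w) :
    ∃ z', P.eval^[k] z' = w ∧ DiscChain W n z z' := by
  induction k generalizing z with
  | zero => exact ⟨w, rfl, h⟩
  | succ k ih =>
    obtain ⟨y, hy, hzy⟩ := ih (z := P.eval z) h
    obtain ⟨z', rfl, hzz'⟩ := hzy.exists_lift hW rfl
    exact ⟨z', hy, hzz'.map differentiable_id hPW⟩

end Lifting

section ConnectedComponent

variable {E : Type*} [NormedAddCommGroup E] [NormedSpace ℂ E] {Ω : Set E} {x y : E}

theorem DiscLinked.connectedComponentIn (h : DiscLinked Ω x y) :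
    DiscLinked (connectedComponentIn Ω x) x y := by
  obtain ⟨f, hf, hfΩ, rfl, hy⟩ := h
  have hconn := Metric.isPreconnected_ball.image f hf.continuousOn
  exact ⟨f, hf, mapsTo_iff_image_subset.2 (hconn.subset_connectedComponentIn
    (mem_image_of_mem f (Metric.mem_ball_self one_pos)) hfΩ.image_subset), rfl, hy⟩

theorem DiscChain.connectedComponentIn {n : ℕ} (h : DiscChain Ω n x y) :
    DiscChain (connectedComponentIn Ω x) n x y := by
  induction h with
  | nil x => exact .nil x
  | cons hlink _ ih =>
    have hlink' := hlink.connectedComponentIn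
    exact .cons hlink' (connectedComponentIn_eq hlink'.mem_right ▸ ih)

theorem DiscChain.mem_right {n : ℕ} (h : DiscChain Ω n x y) (hx : x ∈ Ω) : y ∈ Ω := by
  induction h with
  | nil => exact hx
  | cons hlink _ ih => exact ih hlink.mem_right

end ConnectedComponent

section Basin

variable {X : Type*} [TopologicalSpace X] {F : X → X} {p : X}

theorem iterate_mem_attractingBasin_iff (n : ℕ) {x : X} :
    F^[n] x ∈ attractingBasin F p ↔ x ∈ attractingBasin F p := by
  simp only [attractingBasin, mem_ofPred_eq, ← Function.iterate_add_apply]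
  exact tendsto_add_atTop_iff_nat (f := fun k => F^[k] x) n

theorem mem_attractingBasin_self (hp : F p = p) : p ∈ attractingBasin F p :=
  tendsto_const_nhds.congr fun n => (Function.iterate_fixed hp n).symm

theorem mem_immediateBasin_self (hp : F p = p) : p ∈ immediateBasin F p :=
  mem_connectedComponentIn (mem_attractingBasin_self hp)

theorem immediateBasin_subset_attractingBasin : immediateBasin F p ⊆ attractingBasin F p :=
  connectedComponentIn_subset _ _

theorem isPreconnected_immediateBasin : IsPreconnected (immediateBasin F p) :=
  isPreconnected_connectedComponentIn

theorem connectedComponentIn_attractingBasin {x : X} (hx : x ∈ immediateBasin F p) :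
    connectedComponentIn (attractingBasin F p) x = immediateBasin F p :=
  (connectedComponentIn_eq hx).symm

theorem subset_immediateBasin {T : Set X} (hT : IsPreconnected T)
    (hTB : T ⊆ attractingBasin F p) (hne : (T ∩ immediateBasin F p).Nonempty) :
    T ⊆ immediateBasin F p := by
  obtain ⟨x, hxT, hx⟩ := hne
  rw [← connectedComponentIn_attractingBasin hx]
  exact hT.subset_connectedComponentIn hxT hTB

theorem closure_immediateBasin_inter_attractingBasin (hp : F p = p) :
    closure (immediateBasin F p) ∩ attractingBasin F p = immediateBasin F p := by
  refine Subset.antisymm (subset_immediateBasin ?_ inter_subset_right ?_)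
    (subset_inter subset_closure immediateBasin_subset_attractingBasin)
  · exact isPreconnected_immediateBasin.subset_closure
      (subset_inter subset_closure immediateBasin_subset_attractingBasin) inter_subset_left
  · exact ⟨p, ⟨subset_closure (mem_immediateBasin_self hp), mem_attractingBasin_self hp⟩,
      mem_immediateBasin_self hp⟩

theorem mapsTo_immediateBasin (hF : Continuous F) (hp : F p = p) :
    MapsTo F (immediateBasin F p) (immediateBasin F p) := by
  refine mapsTo_iff_image_subset.2 (subset_immediateBasin
    (isPreconnected_immediateBasin.image F hF.continuousOn) ?_
    ⟨p, ⟨p, mem_immediateBasin_self hp, hp⟩, mem_immediateBasin_self hp⟩)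
  rintro _ ⟨x, hx, rfl⟩
  exact (iterate_mem_attractingBasin_iff 1).2 (immediateBasin_subset_attractingBasin hx)

theorem isOpen_attractingBasin (hF : Continuous F) (h : attractingBasin F p ∈ 𝓝 p) :
    IsOpen (attractingBasin F p) := by
  refine isOpen_iff_mem_nhds.2 fun x (hx : Tendsto (fun n => F^[n] x) atTop (𝓝 p)) => ?_
  obtain ⟨n, hn⟩ := (hx.eventually (eventually_mem_nhds_iff.2 h)).exists
  filter_upwards [(hF.iterate n).continuousAt.preimage_mem_nhds hn] with y hy
  exact (iterate_mem_attractingBasin_iff n).1 hy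

theorem isOpen_immediateBasin [LocallyConnectedSpace X] (hF : Continuous F)
    (h : attractingBasin F p ∈ 𝓝 p) : IsOpen (immediateBasin F p) :=
  (isOpen_attractingBasin hF h).connectedComponentIn

theorem surjOn_immediateBasin (hF_open : IsOpenMap F) (hF_closed : IsClosedMap F)
    (hp : F p = p) (hΩ : IsOpen (immediateBasin F p)) :
    SurjOn F (immediateBasin F p) (immediateBasin F p) := by
  refine isPreconnected_immediateBasin.subset_of_closure_inter_subset (hF_open _ hΩ)
    ⟨p, mem_immediateBasin_self hp, p, mem_immediateBasin_self hp, hp⟩ ?_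
  rintro y ⟨hy_cl, hy⟩
  obtain ⟨x, hx, rfl⟩ := hF_closed.closure_image_subset _ hy_cl
  refine ⟨x, ?_, rfl⟩
  rw [← closure_immediateBasin_inter_attractingBasin hp]
  exact ⟨hx, (iterate_mem_attractingBasin_iff 1).1 (immediateBasin_subset_attractingBasin hy)⟩

theorem isCompact_inter_immediateBasin {X : Type*} [PseudoMetricSpace X] [ProperSpace X]
    {F : X → X} {p : X} (hp : F p = p) (hΩ : Bornology.IsBounded (immediateBasin F p))
    {K : Set X} (hK : IsClosed K) (hKB : K ⊆ attractingBasin F p) :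
    IsCompact (K ∩ immediateBasin F p) := by
  have hK_eq : K ∩ immediateBasin F p = K ∩ closure (immediateBasin F p) :=
    Subset.antisymm (inter_subset_inter_right K subset_closure) fun x hx =>
      ⟨hx.1, (closure_immediateBasin_inter_attractingBasin hp).subset ⟨hx.2, hKB hx.1⟩⟩
  rw [hK_eq]
  exact Metric.isCompact_of_isClosed_isBounded (hK.inter isClosed_closure)
    (hΩ.closure.subset inter_subset_right)

theorem notMem_attractingBasin_of_mem_frontier_immediateBasin (hp : F p = p)
    (hΩ : IsOpen (immediateBasin F p)) {x : X} (hx : x ∈ frontier (immediateBasin F p)) :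
    x ∉ attractingBasin F p := fun hxB => by
  rw [hΩ.frontier_eq] at hx
  exact hx.2 (closure_immediateBasin_inter_attractingBasin hp ▸ ⟨hx.1, hxB⟩)

theorem attractingBasin_prodMap {Y : Type*} [TopologicalSpace Y] (F : X → X) (G : Y → Y)
    (p : X) (q : Y) :
    attractingBasin (Prod.map F G) (p, q) = attractingBasin F p ×ˢ attractingBasin G q := by
  ext x
  simp only [attractingBasin, mem_ofPred_eq, mem_prod, Prod.map_iterate, Prod.tendsto_iff,
    Prod.map_fst, Prod.map_snd]

theorem immediateBasin_prodMap {Y : Type*} [TopologicalSpace Y] {G : Y → Y} {q : Y}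
    (hp : F p = p) (hq : G q = q) :
    immediateBasin (Prod.map F G) (p, q) = immediateBasin F p ×ˢ immediateBasin G q := by
  have hpq : (p, q) ∈ immediateBasin (Prod.map F G) (p, q) :=
    mem_immediateBasin_self (Prod.ext hp hq)
  have hsub : immediateBasin (Prod.map F G) (p, q) ⊆ attractingBasin F p ×ˢ attractingBasin G q :=
    attractingBasin_prodMap F G p q ▸ immediateBasin_subset_attractingBasin
  have hfst : Prod.fst '' immediateBasin (Prod.map F G) (p, q) ⊆ immediateBasin F p :=
    subset_immediateBasin (isPreconnected_immediateBasin.image _ continuous_fst.continuousOn)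
      (image_subset_iff.2 fun x hx => (hsub hx).1) ⟨p, ⟨_, hpq, rfl⟩, mem_immediateBasin_self hp⟩
  have hsnd : Prod.snd '' immediateBasin (Prod.map F G) (p, q) ⊆ immediateBasin G q :=
    subset_immediateBasin (isPreconnected_immediateBasin.image _ continuous_snd.continuousOn)
      (image_subset_iff.2 fun x hx => (hsub hx).2) ⟨q, ⟨_, hpq, rfl⟩, mem_immediateBasin_self hq⟩
  refine Subset.antisymm (fun x hx => ⟨hfst ⟨x, hx, rfl⟩, hsnd ⟨x, hx, rfl⟩⟩)
    (subset_immediateBasin (isPreconnected_immediateBasin.prod isPreconnected_immediateBasin) ?_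
      ⟨(p, q), ⟨mem_immediateBasin_self hp, mem_immediateBasin_self hq⟩, hpq⟩)
  rw [attractingBasin_prodMap]
  exact prod_mono immediateBasin_subset_attractingBasin immediateBasin_subset_attractingBasin

end Basin

section Trapping

/-- The ball of radius `r` about `p` is a trapping region for `f`: it is forward invariant, and all
orbits starting in its closure converge to `p`. -/
structure IsTrappingRadius {X : Type*} [PseudoMetricSpace X] (f : X → X) (p : X) (r : ℝ) :
    Prop where
  pos : 0 < r
  mapsTo_ball : MapsTo f (Metric.ball p r) (Metric.ball p r)
  closedBall_subset : Metric.closedBall p r ⊆ attractingBasin f p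

namespace IsTrappingRadius

variable {X : Type*} [PseudoMetricSpace X] {f : X → X} {p : X} {r : ℝ}

theorem of_dist_le {κ : ℝ≥0} (hκ : κ < 1) (hr : 0 < r)
    (hf : ∀ x ∈ Metric.closedBall p r, dist (f x) p ≤ κ * dist x p) : IsTrappingRadius f p r := by
  have hdist : ∀ x ∈ Metric.closedBall p r, dist (f x) p ≤ dist x p := fun x hx =>
    (hf x hx).trans (mul_le_of_le_one_left dist_nonneg hκ.le)
  refine ⟨hr, fun x hx => (hdist x (Metric.ball_subset_closedBall hx)).trans_lt hx,
    fun x hx => tendsto_iff_dist_tendsto_zero.2 ?_⟩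
  have hmem : ∀ n, f^[n] x ∈ Metric.closedBall p r := fun n =>
    MapsTo.iterate (fun y hy => (hdist y hy).trans hy) n hx
  have hpow : ∀ n, dist (f^[n] x) p ≤ κ ^ n * dist x p := by
    intro n
    induction n with
    | zero => simp
    | succ n ih =>
      rw [Function.iterate_succ_apply', pow_succ', mul_assoc]
      exact (hf _ (hmem n)).trans (mul_le_mul_of_nonneg_left ih κ.coe_nonneg)
  refine squeeze_zero (fun _ => dist_nonneg) hpow ?_
  simpa using (tendsto_pow_atTop_nhds_zero_of_lt_one κ.coe_nonneg hκ).mul_const (dist x p)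

theorem attractingBasin_mem_nhds (h : IsTrappingRadius f p r) : attractingBasin f p ∈ 𝓝 p :=
  mem_of_superset (Metric.closedBall_mem_nhds p h.pos) h.closedBall_subset

theorem preimage_closedBall_subset (h : IsTrappingRadius f p r) (n : ℕ) :
    f^[n] ⁻¹' Metric.closedBall p r ⊆ attractingBasin f p := fun _ hx =>
  (iterate_mem_attractingBasin_iff n).1 (h.closedBall_subset hx)

theorem monotone_preimage_ball (h : IsTrappingRadius f p r) :
    Monotone fun n => f^[n] ⁻¹' Metric.ball p r :=
  monotone_nat_of_le_succ fun n x hx => by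
    simpa only [mem_preimage, Function.iterate_succ_apply'] using h.mapsTo_ball hx

theorem exists_iterate_mem_ball (h : IsTrappingRadius f p r) {x : X}
    (hx : x ∈ attractingBasin f p) : ∃ n, f^[n] x ∈ Metric.ball p r :=
  (Tendsto.eventually hx (Metric.ball_mem_nhds p h.pos)).exists

theorem exists_subset_preimage_ball (h : IsTrappingRadius f p r) (hf : Continuous f) {K : Set X}
    (hK : IsCompact K) (hKB : K ⊆ attractingBasin f p) :
    ∃ n, K ⊆ f^[n] ⁻¹' Metric.ball p r :=
  hK.elim_directed_cover _ (fun n => Metric.isOpen_ball.preimage (hf.iterate n))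
    (fun _ hx => mem_iUnion.2 (h.exists_iterate_mem_ball (hKB hx)))
    h.monotone_preimage_ball.directed_le

theorem exists_iterate_mem_diff (h : IsTrappingRadius f p r) (m : ℕ) {x : X}
    (hx : x ∈ attractingBasin f p) (hxm : x ∉ f^[m] ⁻¹' Metric.ball p r) :
    ∃ k, f^[k] x ∈ f^[m + 1] ⁻¹' Metric.closedBall p r \ f^[m] ⁻¹' Metric.ball p r := by
  have hentry : ∃ k, f^[k] x ∈ f^[m] ⁻¹' Metric.ball p r := by
    obtain ⟨n, hn⟩ := h.exists_iterate_mem_ball hx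
    refine ⟨n, ?_⟩
    rw [mem_preimage, ← Function.iterate_add_apply]
    exact h.monotone_preimage_ball (Nat.le_add_left n m) hn
  obtain ⟨k, hk, hk'⟩ := Nat.exists_not_and_succ_of_not_zero_of_exists hxm hentry
  refine ⟨k, Metric.ball_subset_closedBall ?_, hk⟩
  rwa [mem_preimage, Function.iterate_succ_apply', ← Function.iterate_succ_apply] at hk'

end IsTrappingRadius

theorem eventually_isTrappingRadius {𝕜 E : Type*} [NontriviallyNormedField 𝕜]
    [NormedAddCommGroup E] [NormedSpace 𝕜 E] {f : E → E} {f' : E →L[𝕜] E} {p : E}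
    (hf : HasFDerivAt f f' p) (hf' : ‖f'‖ < 1) (hp : f p = p) :
    ∀ᶠ r in 𝓝[>] 0, IsTrappingRadius f p r := by
  obtain ⟨κ, hκ, hκ1⟩ := exists_between (show ‖f'‖₊ < 1 from hf')
  have hcontr : ∀ᶠ x in 𝓝 p, dist (f x) p ≤ κ * dist x p := by
    filter_upwards [hf.isLittleO.def (sub_pos.2 (show ‖f'‖ < κ from hκ))] with x hx
    rw [hp] at hx
    calc dist (f x) p = ‖f' (x - p) + (f x - p - f' (x - p))‖ := by
          rw [add_sub_cancel, dist_eq_norm]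
      _ ≤ ‖f'‖ * ‖x - p‖ + (κ - ‖f'‖) * ‖x - p‖ := norm_add_le_of_le (f'.le_opNorm _) hx
      _ = κ * dist x p := by rw [← add_mul, add_sub_cancel, dist_eq_norm]
  obtain ⟨ε, hε, hball⟩ := Metric.nhds_basis_closedBall.eventually_iff.1 hcontr
  filter_upwards [Ioc_mem_nhdsGT hε] with r hr
  exact .of_dist_le hκ1 hr.1 fun x hx => hball (Metric.closedBall_subset_closedBall hr.2 hx)

end Trapping

section Preimage

theorem le_mul_norm_deriv_of_forall_mem_frontier_le {h : ℂ → ℂ} {U : Set ℂ} {p : ℂ} {r D : ℝ}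
    (hU : Bornology.IsBounded U) (hpU : U ∈ 𝓝 p) (hh : DiffContOnCl ℂ h U)
    (hne : ∀ z ∈ U, h z = h p → z = p) (hderiv : deriv h p ≠ 0) (hr : 0 < r)
    (hD : ∀ z ∈ frontier U, ‖z - p‖ ≤ D) (hhr : ∀ z ∈ frontier U, r ≤ ‖h z - h p‖) :
    r ≤ D * ‖deriv h p‖ := by
  have hslope : ∀ z, ‖z - p‖ * ‖dslope h p z‖ = ‖h z - h p‖ := fun z => by
    rw [← norm_smul, sub_smul_dslope]
  have hslope_diff : DiffContOnCl ℂ (dslope h p) U :=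
    ⟨(Complex.differentiableOn_dslope hpU).2 hh.1,
      (continuousOn_dslope (mem_of_superset hpU subset_closure)).2
        ⟨hh.2, hh.1.differentiableAt hpU⟩⟩
  have hfront : ∀ z ∈ frontier U, r ≤ D * ‖dslope h p z‖ := fun z hz =>
    (hhr z hz).trans <| (hslope z).symm.trans_le <| by gcongr; exact hD z hz
  have hslope_ne : ∀ z ∈ closure U, dslope h p z ≠ 0 := by
    intro z hz hz0
    rw [closure_eq_self_union_frontier] at hz
    rcases hz with hzU | hzf
    · have hzp := hne z hzU (sub_eq_zero.1 (norm_eq_zero.1 (by simp [← hslope, hz0])))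
      exact hderiv (by rwa [hzp, dslope_same] at hz0)
    · exact hr.not_ge (by simpa [hz0] using hfront z hzf)
  have hmax : ‖(dslope h p p)⁻¹‖ ≤ D / r :=
    Complex.norm_le_of_forall_mem_frontier_norm_le hU (hslope_diff.inv hslope_ne)
      (fun z hz => by
        have hpos := norm_pos_iff.2 (hslope_ne z (frontier_subset_closure hz))
        rw [Pi.inv_apply, norm_inv, inv_le_iff_one_le_mul₀ hpos, div_mul_eq_mul_div, one_le_div hr]
        exact hfront z hz)
      (subset_closure (mem_of_mem_nhds hpU))
  rwa [dslope_same, norm_inv, inv_le_iff_one_le_mul₀ (norm_pos_iff.2 hderiv), div_mul_eq_mul_div,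
    one_le_div hr] at hmax

theorem exists_mem_immediateBasin_ne_eq {f : ℂ → ℂ} {p : ℂ} (hf : Differentiable ℂ f)
    (hp : f p = p) (hpos : 0 < ‖deriv f p‖) (hlt : ‖deriv f p‖ < 1)
    (hΩ : Bornology.IsBounded (immediateBasin f p)) :
    ∃ b ∈ immediateBasin f p, b ≠ p ∧ f b = p := by
  by_contra! hno
  have hder : HasDerivAt f (deriv f p) p := (hf p).hasDerivAt
  obtain ⟨r, hr⟩ := (eventually_isTrappingRadius hder.hasFDerivAt (by simpa using hlt) hp).exists
  have hΩo : IsOpen (immediateBasin f p) :=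
    isOpen_immediateBasin hf.continuous hr.attractingBasin_mem_nhds
  have hpΩ : immediateBasin f p ∈ 𝓝 p := hΩo.mem_nhds (mem_immediateBasin_self hp)
  have hiter : ∀ m, ∀ z ∈ immediateBasin f p, f^[m] z = p → z = p := by
    intro m
    induction m with
    | zero => exact fun z _ hz => hz
    | succ m ih =>
      intro z hz hfz
      by_contra hzp
      exact hno z hz hzp (ih (f z) (mapsTo_immediateBasin hf.continuous hp hz) hfz)
  obtain ⟨D, hD⟩ := hΩ.closure.subset_closedBall p
  have hbound : ∀ m : ℕ, r ≤ D * ‖deriv f p‖ ^ m := by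
    intro m
    have hm := (HasDerivAt.iterate p hder hp m).deriv
    rw [← norm_pow, ← hm]
    refine le_mul_norm_deriv_of_forall_mem_frontier_le hΩ hpΩ (hf.iterate m).diffContOnCl
      ?_ ?_ hr.pos ?_ ?_
    · simpa only [Function.iterate_fixed hp] using hiter m
    · exact hm ▸ pow_ne_zero m (norm_pos_iff.1 hpos)
    · exact fun z hz => mem_closedBall_iff_norm.1 (hD (frontier_subset_closure hz))
    · intro z hz
      by_contra! hzr
      rw [Function.iterate_fixed hp, ← dist_eq_norm] at hzr
      exact notMem_attractingBasin_of_mem_frontier_immediateBasin hp hΩo hz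
        (hr.preimage_closedBall_subset m hzr.le)
  have hlim : Tendsto (fun m => D * ‖deriv f p‖ ^ m) atTop (𝓝 0) := by
    simpa using (tendsto_pow_atTop_nhds_zero_of_lt_one hpos.le hlt).const_mul D
  exact hr.pos.not_ge (ge_of_tendsto' hlim hbound)

end Preimage

section PolynomialDynamics

theorem isBounded_attractingBasin {X : Type*} [PseudoMetricSpace X] {f : X → X} {p : X}
    (hf : ∀ᶠ x in Bornology.cobounded X, dist x p ≤ dist (f x) p) :
    Bornology.IsBounded (attractingBasin f p) := by
  obtain ⟨R, -, hR⟩ := (Metric.hasBasis_cobounded_compl_closedBall p).eventually_iff.1 hf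
  refine (Metric.isBounded_closedBall (x := p) (r := max R 0)).subset
    fun x (hx : Tendsto (fun n => f^[n] x) atTop (𝓝 p)) => ?_
  by_contra! hxR
  rw [Metric.mem_closedBall, not_le, max_lt_iff] at hxR
  have hgrow : ∀ n, dist x p ≤ dist (f^[n] x) p := by
    intro n
    induction n with
    | zero => rfl
    | succ n ih =>
      rw [Function.iterate_succ_apply']
      exact ih.trans (hR (not_le.2 (hxR.1.trans_le ih)))
  exact hxR.2.not_ge (ge_of_tendsto' (tendsto_iff_dist_tendsto_zero.1 hx) hgrow)

theorem eventually_dist_le_dist_eval {P : Polynomial ℂ} (hP : 2 ≤ P.natDegree) (p : ℂ) :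
    ∀ᶠ z in Bornology.cobounded ℂ, dist z p ≤ dist (P.eval z) (P.eval p) := by
  obtain ⟨Q, hQ⟩ := Polynomial.X_sub_C_dvd_sub_C_eval (a := p) (p := P)
  have hdeg : P.natDegree ≤ 1 + Q.natDegree := by
    rw [← Polynomial.natDegree_sub_C (a := P.eval p), hQ, ← Polynomial.natDegree_X_sub_C p]
    exact Polynomial.natDegree_mul_le
  have hQdeg : 0 < Q.degree := Polynomial.natDegree_pos_iff_degree_pos.1 (by omega)
  filter_upwards [(Q.tendsto_norm_atTop hQdeg tendsto_norm_cobounded_atTop).eventually_ge_atTop 1]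
    with z hz
  have hmul : P.eval z - P.eval p = (z - p) * Q.eval z := by
    simpa using congrArg (Polynomial.eval z) hQ
  rw [dist_eq_norm, dist_eq_norm, hmul, norm_mul]
  exact le_mul_of_one_le_right (norm_nonneg _) hz

theorem isOpenMap_polynomial_eval {P : Polynomial ℂ} (hP : 0 < P.natDegree) : IsOpenMap P.eval := by
  refine (AnalyticOnNhd.is_constant_or_isOpenMap
    (P.differentiable.differentiableOn.analyticOnNhd isOpen_univ)).resolve_left ?_
  rintro ⟨w, hw⟩
  have hPw : P = Polynomial.C w := Polynomial.funext fun z => by rw [hw z, Polynomial.eval_C]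
  exact hP.ne' (hPw ▸ Polynomial.natDegree_C w)

/-- The forward orbits of those critical values of `P` whose critical points are attracted to `p`,
together with the common limit `p` of these orbits. -/
def attractedPostcriticalSet (P : Polynomial ℂ) (p : ℂ) : Set ℂ :=
  ⋃ c ∈ {c | P.derivative.eval c = 0 ∧ c ∈ attractingBasin P.eval p},
    insert p (range fun n => P.eval^[n + 1] c)

theorem finite_attracted_critical {P : Polynomial ℂ} (hP : P.derivative ≠ 0) (p : ℂ) :
    {c | P.derivative.eval c = 0 ∧ c ∈ attractingBasin P.eval p}.Finite :=
  (Polynomial.finite_setOfPred_isRoot hP).subset fun _ hc => hc.1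

theorem isCompact_attractedPostcriticalSet {P : Polynomial ℂ} (hP : P.derivative ≠ 0) (p : ℂ) :
    IsCompact (attractedPostcriticalSet P p) :=
  (finite_attracted_critical hP p).isCompact_biUnion fun _ hc =>
    ((tendsto_add_atTop_iff_nat 1).2 hc.2).isCompact_insert_range

theorem countable_attractedPostcriticalSet {P : Polynomial ℂ} (hP : P.derivative ≠ 0) (p : ℂ) :
    (attractedPostcriticalSet P p).Countable :=
  (finite_attracted_critical hP p).countable.biUnion fun _ _ => (countable_range _).insert p

theorem attractedPostcriticalSet_subset {P : Polynomial ℂ} {p : ℂ} (hp : P.eval p = p) :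
    attractedPostcriticalSet P p ⊆ attractingBasin P.eval p :=
  iUnion₂_subset fun _ hc => insert_subset (mem_attractingBasin_self hp) <|
    range_subset_iff.2 fun n => (iterate_mem_attractingBasin_iff (n + 1)).2 hc.2

theorem mapsTo_attractedPostcriticalSet {P : Polynomial ℂ} {p : ℂ} (hp : P.eval p = p) :
    MapsTo P.eval (attractedPostcriticalSet P p) (attractedPostcriticalSet P p) := by
  intro z hz
  obtain ⟨c, hc, hzp | ⟨n, rfl⟩⟩ := mem_iUnion₂.1 hz
  · simpa only [show P.eval z = z by rw [hzp, hp]] using hz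
  · exact mem_biUnion hc (.inr ⟨n + 1, Function.iterate_succ_apply' _ _ _⟩)

theorem preimage_attractingBasin_diff_subset {P : Polynomial ℂ} {p : ℂ} (hp : P.eval p = p) :
    P.eval ⁻¹' (attractingBasin P.eval p \ attractedPostcriticalSet P p) ⊆
      attractingBasin P.eval p \ attractedPostcriticalSet P p := fun _ hz =>
  ⟨(iterate_mem_attractingBasin_iff 1).1 hz.1,
    fun hzS => hz.2 (mapsTo_attractedPostcriticalSet hp hzS)⟩

theorem derivative_eval_ne_zero_of_eval_mem_diff {P : Polynomial ℂ} {p z : ℂ}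
    (hz : P.eval z ∈ attractingBasin P.eval p \ attractedPostcriticalSet P p) :
    P.derivative.eval z ≠ 0 := fun hcrit =>
  hz.2 <| mem_iUnion₂.2
    ⟨z, ⟨hcrit, (iterate_mem_attractingBasin_iff 1).1 hz.1⟩, .inr ⟨0, rfl⟩⟩

end PolynomialDynamics

section AttractingFixedPoint

variable {P : Polynomial ℂ} {p : ℂ}

theorem eventually_isTrappingRadius_polynomial (hp : P.eval p = p)
    (hlt : ‖P.derivative.eval p‖ < 1) : ∀ᶠ r in 𝓝[>] 0, IsTrappingRadius P.eval p r :=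
  eventually_isTrappingRadius (P.hasDerivAt p).hasFDerivAt (by simpa using hlt) hp

theorem isOpen_immediateBasin_polynomial (hp : P.eval p = p)
    (hlt : ‖P.derivative.eval p‖ < 1) : IsOpen (immediateBasin P.eval p) := by
  obtain ⟨r, hr⟩ := (eventually_isTrappingRadius_polynomial hp hlt).exists
  exact isOpen_immediateBasin P.continuous hr.attractingBasin_mem_nhds

theorem isBounded_immediateBasin_polynomial (hP : 2 ≤ P.natDegree) (hp : P.eval p = p) :
    Bornology.IsBounded (immediateBasin P.eval p) := by
  refine (isBounded_attractingBasin ?_).subset immediateBasin_subset_attractingBasin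
  simpa only [hp] using eventually_dist_le_dist_eval hP p

theorem surjOn_immediateBasin_polynomial (hP : 2 ≤ P.natDegree) (hp : P.eval p = p)
    (hlt : ‖P.derivative.eval p‖ < 1) :
    SurjOn P.eval (immediateBasin P.eval p) (immediateBasin P.eval p) :=
  surjOn_immediateBasin (isOpenMap_polynomial_eval (by omega)) P.isClosedMap_eval hp
    (isOpen_immediateBasin_polynomial hp hlt)

theorem exists_isTrappingRadius_forall_exists_notMem (hP : 2 ≤ P.natDegree) (hp : P.eval p = p)
    (hpos : 0 < ‖P.derivative.eval p‖) (hlt : ‖P.derivative.eval p‖ < 1) :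
    ∃ r, IsTrappingRadius P.eval p r ∧ ∀ m, ∃ a ∈ immediateBasin P.eval p,
      a ∉ P.eval^[m] ⁻¹' Metric.ball p r ∧ P.eval^[m + 1] a = p := by
  obtain ⟨b, hbΩ, hbp, hb⟩ := exists_mem_immediateBasin_ne_eq P.differentiable hp
    (by rwa [P.deriv]) (by rwa [P.deriv]) (isBounded_immediateBasin_polynomial hP hp)
  obtain ⟨r, hr, hrb⟩ := ((eventually_isTrappingRadius_polynomial hp hlt).and
    (Ioc_mem_nhdsGT (dist_pos.2 hbp))).exists
  refine ⟨r, hr, fun m => ?_⟩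
  obtain ⟨a, haΩ, rfl⟩ := (surjOn_immediateBasin_polynomial hP hp hlt).iterate m hbΩ
  exact ⟨a, haΩ, hrb.2.not_gt, by rwa [Function.iterate_succ_apply']⟩

theorem isOpen_immediateBasin_diff_attractedPostcriticalSet (hp : P.eval p = p)
    (hpos : 0 < ‖P.derivative.eval p‖) (hlt : ‖P.derivative.eval p‖ < 1) :
    IsOpen (immediateBasin P.eval p \ attractedPostcriticalSet P p) :=
  (isOpen_immediateBasin_polynomial hp hlt).sdiff
    (isCompact_attractedPostcriticalSet (fun h => by simp [h] at hpos) p).isClosed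

theorem isPreconnected_immediateBasin_diff_attractedPostcriticalSet (hp : P.eval p = p)
    (hpos : 0 < ‖P.derivative.eval p‖) (hlt : ‖P.derivative.eval p‖ < 1) :
    IsPreconnected (immediateBasin P.eval p \ attractedPostcriticalSet P p) :=
  isPreconnected_diff_countable (by simp)
    (countable_attractedPostcriticalSet (fun h => by simp [h] at hpos) p)
    (isOpen_immediateBasin_polynomial hp hlt) isPreconnected_immediateBasin

theorem DiscChain.exists_pullback_immediateBasin (hp : P.eval p = p) {n k : ℕ} {z a : ℂ}
    (hz : z ∈ immediateBasin P.eval p)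
    (h : DiscChain (immediateBasin P.eval p \ attractedPostcriticalSet P p) n (P.eval^[k] z) a) :
    ∃ y, P.eval^[k] y = a ∧ DiscChain (immediateBasin P.eval p) n z y := by
  have hB := h.map differentiable_id
    (sdiff_subset_sdiff_left immediateBasin_subset_attractingBasin)
  obtain ⟨y, hya, hzy⟩ := hB.exists_lift_iterate
    (fun z hz => derivative_eval_ne_zero_of_eval_mem_diff hz)
    (preimage_attractingBasin_diff_subset hp) k
  refine ⟨y, hya, ?_⟩
  rw [← connectedComponentIn_attractingBasin hz]
  exact (hzy.map differentiable_id sdiff_subset).connectedComponentIn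

theorem exists_forall_discChain_fundamentalAnnulus (hP : 2 ≤ P.natDegree) (hp : P.eval p = p)
    (hpos : 0 < ‖P.derivative.eval p‖) (hlt : ‖P.derivative.eval p‖ < 1) {r : ℝ}
    (hr : IsTrappingRadius P.eval p r) {m : ℕ}
    (hS : attractedPostcriticalSet P p ⊆ P.eval^[m] ⁻¹' Metric.ball p r) {a : ℂ}
    (haΩ : a ∈ immediateBasin P.eval p) (ham : a ∉ P.eval^[m] ⁻¹' Metric.ball p r) :
    ∃ N, ∀ z ∈ (P.eval^[m + 1] ⁻¹' Metric.closedBall p r \ P.eval^[m] ⁻¹' Metric.ball p r) ∩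
      immediateBasin P.eval p,
        DiscChain (immediateBasin P.eval p \ attractedPostcriticalSet P p) N z a := by
  have hoff : immediateBasin P.eval p \ P.eval^[m] ⁻¹' Metric.ball p r ⊆
      immediateBasin P.eval p \ attractedPostcriticalSet P p := sdiff_subset_sdiff_right hS
  have hclosed : IsClosed (P.eval^[m + 1] ⁻¹' Metric.closedBall p r \
      P.eval^[m] ⁻¹' Metric.ball p r) :=
    (Metric.isClosed_closedBall.preimage (P.continuous.iterate (m + 1))).sdiff
      (Metric.isOpen_ball.preimage (P.continuous.iterate m))
  exact exists_forall_discChain_of_isCompact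
    (isCompact_inter_immediateBasin hp (isBounded_immediateBasin_polynomial hP hp) hclosed
      (sdiff_subset.trans (hr.preimage_closedBall_subset (m + 1))))
    (fun _ hz => hoff ⟨hz.2, hz.1.2⟩)
    (isOpen_immediateBasin_diff_attractedPostcriticalSet hp hpos hlt)
    (isPreconnected_immediateBasin_diff_attractedPostcriticalSet hp hpos hlt) (hoff ⟨haΩ, ham⟩)

theorem exists_forall_discChain_core (hP : 2 ≤ P.natDegree) (hp : P.eval p = p)
    (hlt : ‖P.derivative.eval p‖ < 1) {r : ℝ} (hr : IsTrappingRadius P.eval p r) (m : ℕ) :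
    ∃ N, ∀ z ∈ P.eval^[m] ⁻¹' Metric.closedBall p r ∩ immediateBasin P.eval p,
      DiscChain (immediateBasin P.eval p) N z p :=
  exists_forall_discChain_of_isCompact
    (isCompact_inter_immediateBasin hp (isBounded_immediateBasin_polynomial hP hp)
      (Metric.isClosed_closedBall.preimage (P.continuous.iterate m))
      (hr.preimage_closedBall_subset m))
    inter_subset_right (isOpen_immediateBasin_polynomial hp hlt) isPreconnected_immediateBasin
    (mem_immediateBasin_self hp)

theorem exists_forall_discChain_iterate_eq (hP : 2 ≤ P.natDegree) (hp : P.eval p = p)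
    (hpos : 0 < ‖P.derivative.eval p‖) (hlt : ‖P.derivative.eval p‖ < 1) :
    ∃ N, ∀ z ∈ immediateBasin P.eval p, ∃ y,
      (∃ k, P.eval^[k] y = p) ∧ DiscChain (immediateBasin P.eval p) N z y := by
  obtain ⟨r, hr, hexit⟩ := exists_isTrappingRadius_forall_exists_notMem hP hp hpos hlt
  obtain ⟨m, hSm⟩ := hr.exists_subset_preimage_ball P.continuous
    (isCompact_attractedPostcriticalSet (fun h => by simp [h] at hpos) p)
    (attractedPostcriticalSet_subset hp)
  obtain ⟨a, haΩ, ham, hap⟩ := hexit m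
  obtain ⟨N₁, hN₁⟩ :=
    exists_forall_discChain_fundamentalAnnulus hP hp hpos hlt hr hSm haΩ ham
  obtain ⟨N₂, hN₂⟩ := exists_forall_discChain_core hP hp hlt hr m
  refine ⟨max N₁ N₂, fun z hz => ?_⟩
  by_cases hzm : z ∈ P.eval^[m] ⁻¹' Metric.ball p r
  · exact ⟨p, ⟨0, rfl⟩, (hN₂ z ⟨Metric.ball_subset_closedBall hzm, hz⟩).mono hz (le_max_right _ _)⟩
  · obtain ⟨k, hk⟩ := hr.exists_iterate_mem_diff m (immediateBasin_subset_attractingBasin hz) hzm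
    have hkΩ : P.eval^[k] z ∈ immediateBasin P.eval p :=
      (mapsTo_immediateBasin P.continuous hp).iterate k hz
    obtain ⟨y, hya, hzy⟩ := (hN₁ _ ⟨hk, hkΩ⟩).exists_pullback_immediateBasin hp hz
    exact ⟨y, ⟨m + 1 + k, by rw [Function.iterate_add_apply, hya, hap]⟩,
      hzy.mono hz (le_max_left _ _)⟩

end AttractingFixedPoint

theorem prod_mk_mem_backwardOrbit {X Y : Type*} {F : X → X} {G : Y → Y} {x p : X} {y q : Y}
    {j k : ℕ} (hp : F p = p) (hq : G q = q) (hx : F^[j] x = p) (hy : G^[k] y = q) :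
    (x, y) ∈ backwardOrbit (Prod.map F G) (p, q) := by
  refine mem_iUnion.2 ⟨j + k, ?_⟩
  rw [mem_preimage, mem_singleton_iff, Prod.map_iterate, Prod.map_apply,
    Function.iterate_add_apply G, hy, Function.iterate_fixed hq, add_comm,
    Function.iterate_add_apply, hx, Function.iterate_fixed hp]

theorem theorem3p2_general {P Q : Polynomial ℂ} {a b : ℂ}
    (hPdeg : 2 ≤ P.natDegree) (hQdeg : 2 ≤ Q.natDegree) (ha : P.eval a = a) (hb : Q.eval b = b)
    (hP'pos : 0 < ‖P.derivative.eval a‖) (hP'lt : ‖P.derivative.eval a‖ < 1)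
    (hQ'pos : 0 < ‖Q.derivative.eval b‖) (hQ'lt : ‖Q.derivative.eval b‖ < 1) :
    ∃ C : ℝ≥0, ∀ x ∈ immediateBasin (productMap P Q) (a, b),
      ∃ y ∈ backwardOrbit (productMap P Q) (a, b),
        y ∈ immediateBasin (productMap P Q) (a, b) ∧
          kobayashiDist (immediateBasin (productMap P Q) (a, b)) x y ≤ (C : ℝ≥0∞) := by
  have hF : productMap P Q = Prod.map P.eval Q.eval := rfl
  obtain ⟨N, hN⟩ := exists_forall_discChain_iterate_eq hPdeg ha hP'pos hP'lt
  obtain ⟨M, hM⟩ := exists_forall_discChain_iterate_eq hQdeg hb hQ'pos hQ'lt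
  refine ⟨(M + N + 1 : ℕ), ?_⟩
  rw [hF, immediateBasin_prodMap ha hb]
  rintro ⟨z, w⟩ ⟨hz, hw⟩
  obtain ⟨z', ⟨j, hj⟩, hzz'⟩ := hN z hz
  obtain ⟨w', ⟨k, hk⟩, hww'⟩ := hM w hw
  have hz' := hzz'.mem_right hz
  have hchain := hzz'.prod hww' hw hz'
  exact ⟨(z', w'), prod_mk_mem_backwardOrbit ha hb hj hk, ⟨hz', hww'.mem_right hw⟩,
    by exact_mod_cast hchain.kobayashiDist_le ⟨hz, hw⟩⟩

theorem theorem3p2 (P Q : Polynomial ℂ) (hPdeg : 2 ≤ P.natDegree) (hQdeg : 2 ≤ Q.natDegree)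
    (hP0 : P.eval 0 = 0) (hQ0 : Q.eval 0 = 0)
    (hP'pos : 0 < ‖P.derivative.eval 0‖) (hP'lt : ‖P.derivative.eval 0‖ < 1)
    (hQ'pos : 0 < ‖Q.derivative.eval 0‖) (hQ'lt : ‖Q.derivative.eval 0‖ < 1) :
    ∃ C : ℝ≥0, ∀ x ∈ immediateBasin (productMap P Q) (0, 0),
      ∃ y ∈ backwardOrbit (productMap P Q) (0, 0),
        y ∈ immediateBasin (productMap P Q) (0, 0) ∧
          kobayashiDist (immediateBasin (productMap P Q) (0, 0)) x y ≤ (C : ℝ≥0∞) :=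
  theorem3p2_general hPdeg hQdeg hP0 hQ0 hP'pos hP'lt hQ'pos hQ'lt
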